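/- Let $n\ge 1$ and let $\mathbf u=(u_1,\dots,u_n)\in\mathbb R^n$ satisfy $0\le u_1\le\cdots\le u_n$ and $\mathbf u\ne\mathbf 0$. Let $d_1<\cdots<d_\ell$ ($\ell\ge 1$) be the distinct positive entries of $\mathbf u$, let $m_0$ be the number of entries of $\mathbf u$ equal to $0$, and for $1\le i\le\ell$ let $m_i$ be the number of entries equal to $d_i$; put $\mathbf m=(m_0,m_1,\dots,m_\ell)$ and $\mathbf d=(d_1,\dots,d_\ell)$, so that $m_0+\cdots+m_\ell=n$ and $(\mathbf m,\mathbf d)$ determines $\mathbf u$. A vector $\mathbf a\in\mathbb R^n_{\ge 0}$ is a $\mathbf u$-parking function if its non-decreasing rearrangement $b_1\le\cdots\le b_n$ satisfies $b_i\le u_i$ for all $i$, and the parking function polytope $\mathrm{PF}(\mathbf m,\mathbf d)=\mathrm{PF}(\mathbf u)$ is the convex hull of all $\mathbf u$-parking functions. A polytope of dimension $D$ is called simple if each of its vertices is incident to exactly $D$ edges. Then $\mathrm{PF}(\mathbf m,\mathbf d)$ is a simple polytope if and only if one of the following holds: (a) $\mathbf m=(0,n)$; (b) $\mathbf m=(n-1,1)$;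 (c) $\ell\ge 2$ and $m_1=m_2=\cdots=m_{\ell-1}=1$. -/

import Mathlib

/-- `a ∈ ℝⁿ` is a `u`-parking function: its entries are nonnegative and its non-decreasing
rearrangement `b = a ∘ Tuple.sort a` satisfies `b i ≤ u i` for all `i`. -/
def IsParkingFunction {n : ℕ} (u a : Fin n → ℝ) : Prop :=
  (∀ i, 0 ≤ a i) ∧ ∀ i, a (Tuple.sort a i) ≤ u i

/-- The parking function polytope `PF(u)`: the convex hull of all `u`-parking functions. -/
def parkingPolytope {n : ℕ} (u : Fin n → ℝ) : Set (Fin n → ℝ) :=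
  convexHull ℝ {a | IsParkingFunction u a}

/-- `(m, d)` is the multiplicity-data pair of the nonzero non-decreasing nonnegative vector `u`:
`d = (d₁ < ⋯ < d_ℓ)` lists the distinct positive entries of `u` (here `d i` is `d_{i+1}`), `m 0` is
the number of zero entries, and `m i.succ` is the number of entries equal to `d i`. -/
structure IsMDPair {n ℓ : ℕ} (u : Fin n → ℝ) (m : Fin (ℓ + 1) → ℕ) (d : Fin ℓ → ℝ) : Prop where
  monotone : Monotone u
  nonneg : ∀ j, 0 ≤ u j
  ne_zero : u ≠ 0
  strictMono : StrictMono d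
  range_eq : Set.range d = {x | x ∈ Set.range u ∧ 0 < x}
  mult_zero : m 0 = (Finset.univ.filter fun j => u j = 0).card
  mult_succ : ∀ i : Fin ℓ, m i.succ = (Finset.univ.filter fun j => u j = d i).card

/-- A polytope in `ℝⁿ`: the convex hull of finitely many points. -/
def IsPolytope {n : ℕ} (P : Set (Fin n → ℝ)) : Prop :=
  ∃ s : Finset (Fin n → ℝ), P = convexHull ℝ (s : Set (Fin n → ℝ))

/-- The dimension of a nonempty set in `ℝⁿ`: the dimension of its affine span. -/
noncomputable def affineDim {n : ℕ} (S : Set (Fin n → ℝ)) : ℕ :=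
  Module.finrank ℝ (affineSpan ℝ S).direction

/-- `v` is a vertex of `P`: `{v}` is a face of `P`, where a face is the set of maximizers over `P`
of a linear functional. -/
def IsVertex {n : ℕ} (P : Set (Fin n → ℝ)) (v : Fin n → ℝ) : Prop :=
  IsExposed ℝ P {v}

/-- `E` is an edge of `P`: a one-dimensional face. -/
def IsEdge {n : ℕ} (P E : Set (Fin n → ℝ)) : Prop :=
  IsExposed ℝ P E ∧ affineDim E = 1

/-- A polytope is simple if every vertex is incident to exactly `dim P` edges. -/
def IsSimplePolytope {n : ℕ} (P : Set (Fin n → ℝ)) : Prop :=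
  IsPolytope P ∧
    ∀ v, IsVertex P v → {E | IsEdge P E ∧ v ∈ E}.encard = (affineDim P : ℕ∞)

/-!
Up to permuting coordinates, the vertices of `PF(u)` are the vectors obtained from `u` by replacing
the first `k` entries by zero. The polytope is stable under exchanging two coordinates and under
replacing a coordinate by zero; the second is an exchange with an additional coordinate, the ground,
whose value is always zero.

If `u` is of one of the three types, then at each vertex one can move within the polytope along the
exchanges given by the edges of a suitable forest rooted at the ground. The sums over the
descendants of a coordinate are dual to these exchanges and extremal at the vertex, so the cone at
the vertex is simplicial and there are exactly `n` edges.

Conversely, each pair of coordinates with consecutive values, the ground included, gives an edge at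
the vertex `u`. There are at least `n` such pairs, and there are more than `n` if a positive value
other than the maximum is repeated, or if zero occurs and the only positive value is repeated.
-/

namespace ParkingPolytope

section Face

variable {E : Type*} [AddCommGroup E] [Module ℝ E]

/-- The slice of `P` by the affine subspace through `v` with direction `W`. Every face of a polytope
through a point `v` of the face has this form, with `W` the direction of the face. -/
def faceAlong (P : Set E) (v : E) (W : Submodule ℝ E) : Set E :=
  {x ∈ P | x - v ∈ W}

variable {P : Set E} {v w w' : E} {W : Submodule ℝ E}

theorem self_mem_faceAlong (hv : v ∈ P) : v ∈ faceAlong P v W :=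
  ⟨hv, by simp⟩

theorem add_mem_faceAlong_iff : v + w ∈ faceAlong P v W ↔ v + w ∈ P ∧ w ∈ W := by
  simp [faceAlong]

theorem mem_span_singleton_of_faceAlong_eq (hw : v + w ∈ P)
    (h : faceAlong P v (ℝ ∙ w) = faceAlong P v (ℝ ∙ w')) : w ∈ ℝ ∙ w' :=
  (add_mem_faceAlong_iff.1
    (h ▸ add_mem_faceAlong_iff.2 ⟨hw, Submodule.mem_span_singleton_self w⟩)).2

theorem isExposed_faceAlong [TopologicalSpace E] {κ : Type*} [Finite κ]
    (hv : v ∈ P) (g : κ → StrongDual ℝ E) (hmax : ∀ i, ∀ x ∈ P, g i x ≤ g i v)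
    (hker : ∀ y, y ∈ W ↔ ∀ i, g i y = 0) : IsExposed ℝ P (faceAlong P v W) := by
  have := Fintype.ofFinite κ
  refine fun _ => ⟨∑ i, g i, Set.ext fun x => and_congr_right fun hx => ?_⟩
  have hle : ∀ y ∈ P, ∑ i, g i y ≤ ∑ i, g i v := fun y hy =>
    Finset.sum_le_sum fun i _ => hmax i y hy
  have heq : ∑ i, g i x = ∑ i, g i v ↔ ∀ i, g i x = g i v := by
    simpa using Finset.sum_eq_sum_iff_of_le fun i (_ : i ∈ Finset.univ) => hmax i x hx
  simp only [hker, map_sub, sub_eq_zero, FunLike.coe_sum, Finset.sum_apply, ← heq]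
  exact ⟨fun h y hy => h ▸ hle y hy, fun h => (hle x hx).antisymm (h v hv)⟩

end Face

theorem affineDim_faceAlong {n : ℕ} {P : Set (Fin n → ℝ)} {v : Fin n → ℝ} {s : Set (Fin n → ℝ)}
    (hv : v ∈ P) (hs : ∀ w ∈ s, v + w ∈ P) :
    affineDim (faceAlong P v (Submodule.span ℝ s)) = Module.finrank ℝ (Submodule.span ℝ s) := by
  have hspan : Submodule.span ℝ ((· -ᵥ v) '' faceAlong P v (Submodule.span ℝ s)) =
      Submodule.span ℝ s := by
    refine le_antisymm (Submodule.span_le.2 ?_) (Submodule.span_mono fun w hw => ?_)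
    · rintro _ ⟨x, hx, rfl⟩
      exact hx.2
    · exact ⟨v + w, add_mem_faceAlong_iff.2 ⟨hs w hw, Submodule.subset_span hw⟩, by simp⟩
  rw [affineDim, direction_affineSpan,
    vectorSpan_eq_span_vsub_set_right ℝ (self_mem_faceAlong hv), hspan]

theorem isEdge_faceAlong {n : ℕ} {P : Set (Fin n → ℝ)} {v w : Fin n → ℝ} (hv : v ∈ P)
    (hvw : v + w ∈ P) (hw : w ≠ 0) {κ : Type*} [Finite κ] (g : κ → StrongDual ℝ (Fin n → ℝ))
    (hmax : ∀ i, ∀ x ∈ P, g i x ≤ g i v) (hker : ∀ y, y ∈ ℝ ∙ w ↔ ∀ i, g i y = 0) :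
    IsEdge P (faceAlong P v (ℝ ∙ w)) :=
  ⟨isExposed_faceAlong hv g hmax hker,
    (affineDim_faceAlong hv (by simpa using hvw)).trans (finrank_span_singleton hw)⟩

/-- The cone of `P` at `v` is simplicial: it is contained in the cone generated by a basis `b` of
the ambient space, and `P` contains a segment from `v` in each of the basis directions, normalised
to have length one. -/
structure IsSimplicialAt {n : ℕ} {ι : Type*} (P : Set (Fin n → ℝ)) (v : Fin n → ℝ)
    (b : Module.Basis ι ℝ (Fin n → ℝ)) : Prop where
  mem : v ∈ P
  add_mem : ∀ i, v + b i ∈ P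
  coord_nonneg : ∀ x ∈ P, ∀ i, 0 ≤ b.coord i (x - v)

namespace IsSimplicialAt

variable {n : ℕ} {ι : Type*} {P : Set (Fin n → ℝ)} {v : Fin n → ℝ}
  {b : Module.Basis ι ℝ (Fin n → ℝ)}

theorem faceAlong_injective (h : IsSimplicialAt P v b) :
    Function.Injective fun i => faceAlong P v (ℝ ∙ b i) := fun i j hij => by
  have hmem := mem_span_singleton_of_faceAlong_eq (h.add_mem i) hij
  rw [← Set.image_singleton, b.mem_span_image] at hmem
  simpa using hmem

theorem map (h : IsSimplicialAt P v b) {e : (Fin n → ℝ) ≃ₗ[ℝ] Fin n → ℝ}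
    (he : ∀ x, e x ∈ P ↔ x ∈ P) : IsSimplicialAt P (e v) (b.map e) where
  mem := (he v).2 h.mem
  add_mem i := by
    rw [Module.Basis.map_apply, ← map_add]
    exact (he _).2 (h.add_mem i)
  coord_nonneg x hx i := by
    have hx' : e.symm x ∈ P := (he _).1 (by rwa [e.apply_symm_apply])
    simpa using h.coord_nonneg _ hx' i

variable [Finite ι]

theorem isEdge_faceAlong (h : IsSimplicialAt P v b) (i : ι) :
    IsEdge P (faceAlong P v (ℝ ∙ b i)) := by
  refine ParkingPolytope.isEdge_faceAlong h.mem (h.add_mem i) (b.ne_zero i)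
    (fun j : {j // j ≠ i} => LinearMap.toContinuousLinearMap (-b.coord j)) ?_ fun y => ?_
  · intro j x hx
    simpa [sub_nonneg] using h.coord_nonneg x hx j
  · rw [← Set.image_singleton, b.mem_span_image, Finsupp.support_subset_iff]
    simp

/-- On `P`, the defect `l v - l x` is a sum of nonnegative terms, one for each basis direction. The
face exposed by `l` is cut out by the directions in which `l` decreases. -/
theorem exists_eq_faceAlong (h : IsSimplicialAt P v b) {F : Set (Fin n → ℝ)}
    (hF : IsExposed ℝ P F) (hv : v ∈ F) :
    ∃ I : Set ι, F = faceAlong P v (Submodule.span ℝ (b '' I)) := by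
  have := Fintype.ofFinite ι
  obtain ⟨l, rfl⟩ := hF ⟨v, hv⟩
  have hmax : ∀ y ∈ P, l y ≤ l v := hv.2
  have hb : ∀ i, l (b i) ≤ 0 := fun i => by simpa using hmax _ (h.add_mem i)
  refine ⟨{i | l (b i) = 0}, Set.ext fun x => and_congr_right fun hx => ?_⟩
  have hsum : l (x - v) = ∑ i, b.coord i (x - v) * l (b i) := by
    conv_lhs => rw [← b.sum_repr (x - v)]
    simp
  have hterm : ∀ i ∈ Finset.univ, b.coord i (x - v) * l (b i) ≤ 0 := fun i _ =>
    mul_nonpos_of_nonneg_of_nonpos (h.coord_nonneg x hx i) (hb i)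
  calc (∀ y ∈ P, l y ≤ l x) ↔ l (x - v) = 0 := by
        rw [map_sub, sub_eq_zero]
        exact ⟨fun hy => (hmax x hx).antisymm (hy v h.mem), fun hy => hy ▸ hmax⟩
    _ ↔ ∀ i, b.coord i (x - v) * l (b i) = 0 := by
        rw [hsum, Finset.sum_eq_zero_iff_of_nonpos hterm]
        simp only [Finset.mem_univ, true_imp_iff]
    _ ↔ x - v ∈ Submodule.span ℝ (b '' {i | l (b i) = 0}) := by
        rw [b.mem_span_image, Finsupp.support_subset_iff]
        simp only [mul_eq_zero, Set.mem_ofPred_eq, Module.Basis.coord_apply]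
        exact forall_congr' fun i => or_iff_not_imp_right

theorem exists_eq_faceAlong_singleton (h : IsSimplicialAt P v b) {F : Set (Fin n → ℝ)}
    (hF : IsEdge P F) (hv : v ∈ F) : ∃ i, F = faceAlong P v (ℝ ∙ b i) := by
  obtain ⟨I, rfl⟩ := h.exists_eq_faceAlong hF.1 hv
  have := Fintype.ofFinite I
  have hcard := affineDim_faceAlong h.mem
    (Set.forall_mem_image.2 fun i (_ : i ∈ I) => h.add_mem i)
  have hli : LinearIndependent ℝ fun i : I => b i :=
    b.linearIndependent.comp _ Subtype.val_injective
  rw [hF.2, Set.image_eq_range, finrank_span_eq_card hli, ← Nat.card_eq_fintype_card,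
    Nat.card_coe_set_eq] at hcard
  obtain ⟨i, rfl⟩ := Set.ncard_eq_one.1 hcard.symm
  exact ⟨i, by rw [Set.image_singleton]⟩

theorem encard_edges (h : IsSimplicialAt P v b) :
    {F | IsEdge P F ∧ v ∈ F}.encard = ENat.card ι := by
  have hrange : {F | IsEdge P F ∧ v ∈ F} = Set.range fun i => faceAlong P v (ℝ ∙ b i) := by
    ext F
    constructor
    · rintro ⟨hF, hv⟩
      obtain ⟨i, rfl⟩ := h.exists_eq_faceAlong_singleton hF hv
      exact ⟨i, rfl⟩
    · rintro ⟨i, rfl⟩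
      exact ⟨h.isEdge_faceAlong i, self_mem_faceAlong h.mem⟩
  rw [hrange, ← Set.image_univ, h.faceAlong_injective.encard_image, Set.encard_univ]

theorem exists_of_dual {w : Fin n → Fin n → ℝ} {f : Fin n → Module.Dual ℝ (Fin n → ℝ)}
    (hv : v ∈ P) (hw : ∀ i, v + w i ∈ P) (hpos : ∀ i, 0 < f i (w i))
    (hzero : ∀ i j, i ≠ j → f i (w j) = 0) (hle : ∀ x ∈ P, ∀ i, f i v ≤ f i x) :
    ∃ b : Module.Basis (Fin n) ℝ (Fin n → ℝ), IsSimplicialAt P v b := by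
  have happly : ∀ (c : Fin n → ℝ) i, f i (∑ j, c j • w j) = c i * f i (w i) := fun c i => by
    rw [map_sum, Finset.sum_eq_single i (fun j _ hj => by simp [hzero i j hj.symm]) (by simp),
      map_smul, smul_eq_mul]
  have hli : LinearIndependent ℝ w := Fintype.linearIndependent_iff.2 fun c hc i => by
    have := happly c i
    rw [hc, map_zero] at this
    exact (mul_eq_zero.1 this.symm).resolve_right (hpos i).ne'
  let b := Module.Basis.mk hli (hli.span_eq_top_of_card_eq_finrank' (by simp)).ge
  have hb : ⇑b = w := Module.Basis.coe_mk _ _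
  refine ⟨b, hv, fun i => hb ▸ hw i, fun x hx i => ?_⟩
  have hcoord : f i (x - v) = b.coord i (x - v) * f i (w i) := by
    conv_lhs => rw [← b.sum_repr (x - v), hb, happly]
    rfl
  refine nonneg_of_mul_nonneg_left ?_ (hpos i)
  rw [← hcoord, map_sub]
  exact sub_nonneg.2 (hle x hx i)

end IsSimplicialAt

section Forest

variable {ι : Type*}

/-- The extension of `u` by an entry `0` at the additional index `none`, the ground. Moving a
coordinate of a parking function to the ground means replacing it by zero. -/
def grounded (u : ι → ℝ) (i : Option ι) : ℝ := i.elim 0 u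

@[simp] theorem grounded_none (u : ι → ℝ) : grounded u none = 0 := rfl

@[simp] theorem grounded_some (u : ι → ℝ) (i : ι) : grounded u (some i) = u i := rfl

variable [DecidableEq ι]

/-- The vector `e_i - e_j`, where `e_i` is the standard basis vector for `i : ι`, and zero for the
ground `i = none`. -/
def exchange (i : Option ι) (j : ι) : ι → ℝ :=
  fun a => (if some a = i then 1 else 0) - if a = j then 1 else 0

theorem exchange_self_right {i : Option ι} {j : ι} (h : i ≠ some j) : exchange i j j = -1 := by
  simp [exchange, h.symm]

theorem sum_exchange (T : Finset ι) (i : Option ι) (j : ι) :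
    ∑ a ∈ T, exchange i j a =
      (if i ∈ T.map .some then 1 else 0) - if j ∈ T then 1 else 0 := by
  cases i <;> simp [exchange, Finset.sum_sub_distrib]

/-- `p` is the parent map of a rooted forest on `ι` whose roots are the `j` with `p j = none`, and
`T j` is the set of descendants of `j`. -/
structure IsForest (p : ι → Option ι) (T : ι → Finset ι) : Prop where
  self_mem : ∀ j, j ∈ T j
  parent_notMem : ∀ j, p j ∉ (T j).map .some
  parent_mem_iff : ∀ j l, l ≠ j → (p l ∈ (T j).map .some ↔ l ∈ T j)

theorem IsForest.sum_exchange {p : ι → Option ι} {T : ι → Finset ι} (h : IsForest p T) (j l : ι) :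
    ∑ a ∈ T j, exchange (p l) l a = if l = j then -1 else 0 := by
  rw [ParkingPolytope.sum_exchange]
  split_ifs with _ _ hlj <;> simp_all [h.self_mem, h.parent_notMem, h.parent_mem_iff]

end Forest

theorem IsForest.exists_isSimplicialAt {n : ℕ} {P : Set (Fin n → ℝ)} {v : Fin n → ℝ}
    {p : Fin n → Option (Fin n)} {T : Fin n → Finset (Fin n)} (h : IsForest p T) (hv : v ∈ P)
    (hmove : ∀ j, ∃ c : ℝ, c ≠ 0 ∧ v + c • exchange (p j) j ∈ P ∧
      ∀ x ∈ P, 0 ≤ c * (∑ i ∈ T j, v i - ∑ i ∈ T j, x i)) :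
    ∃ b : Module.Basis (Fin n) ℝ (Fin n → ℝ), IsSimplicialAt P v b := by
  choose c hc hmem hle using hmove
  let f (j : Fin n) : Module.Dual ℝ (Fin n → ℝ) := -c j • ∑ i ∈ T j, LinearMap.proj i
  have hf : ∀ j x, f j x = -c j * ∑ i ∈ T j, x i := by simp [f]
  have hdual : ∀ j l, f j (c l • exchange (p l) l) = if l = j then c j * c l else 0 := by
    intro j l
    rw [map_smul, hf, h.sum_exchange, smul_eq_mul]
    split_ifs <;> ring
  refine IsSimplicialAt.exists_of_dual (f := f) hv hmem (fun j => ?_) (fun j l hjl => ?_)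
    fun x hx j => ?_
  · simpa [hdual] using hc j
  · simp [hdual, hjl.symm]
  · linarith [hle j x hx, hf j x, hf j v]

section Polytope

variable {n : ℕ} {u : Fin n → ℝ}

theorem isParkingFunction_iff_exists_perm (hu : Monotone u) {a : Fin n → ℝ} :
    IsParkingFunction u a ↔
      (∀ i, 0 ≤ a i) ∧ ∃ σ : Equiv.Perm (Fin n), ∀ i, a i ≤ u (σ i) := by
  refine and_congr_right fun _ => ⟨fun h => ⟨(Tuple.sort a).symm, fun i => ?_⟩, ?_⟩
  · simpa using h ((Tuple.sort a).symm i)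
  -- If `u i < b i` for the rearrangement `b`, then the `n - i` indices `j ≥ i` are all mapped by
  -- `σ ∘ sort a` into the `n - i - 1` indices greater than `i`.
  rintro ⟨σ, h⟩ i
  by_contra! hlt
  have hcard : (Finset.Ioi i).card < (Finset.Ici i).card := by
    rw [Fin.card_Ioi, Fin.card_Ici]
    lia
  refine hcard.not_ge <| Finset.card_le_card_of_injOn (fun j => σ (Tuple.sort a j)) (fun j hj => ?_)
      ((σ.injective.comp (Tuple.sort a).injective).injOn)
  rw [Finset.mem_coe, Finset.mem_Ici] at hj
  rw [Finset.mem_coe, Finset.mem_Ioi]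
  by_contra! hle
  have hmono : a (Tuple.sort a i) ≤ a (Tuple.sort a j) := Tuple.monotone_sort a hj
  linarith [h (Tuple.sort a j), hu hle]

theorem mem_parkingPolytope_of_le (hu : Monotone u) {a : Fin n → ℝ} (h0 : ∀ i, 0 ≤ a i)
    (σ : Equiv.Perm (Fin n)) (h : ∀ i, a i ≤ u (σ i)) : a ∈ parkingPolytope u :=
  subset_convexHull ℝ _ ((isParkingFunction_iff_exists_perm hu).2 ⟨h0, σ, h⟩)

theorem le_of_forall_isParkingFunction {g : Module.Dual ℝ (Fin n → ℝ)} {c : ℝ}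
    (h : ∀ a, IsParkingFunction u a → g a ≤ c) {x : Fin n → ℝ} (hx : x ∈ parkingPolytope u) :
    g x ≤ c :=
  convexHull_min (t := {x | g x ≤ c}) h (convex_halfSpace_le g.isLinear c) hx

theorem map_mem_parkingPolytope {m : ℕ} {u' : Fin m → ℝ} {f : (Fin n → ℝ) →ₗ[ℝ] Fin m → ℝ}
    (h : ∀ a, IsParkingFunction u a → IsParkingFunction u' (f a)) {x : Fin n → ℝ}
    (hx : x ∈ parkingPolytope u) : f x ∈ parkingPolytope u' :=
  convexHull_min (t := f ⁻¹' parkingPolytope u') (fun a ha => subset_convexHull ℝ _ (h a ha))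
    ((convex_convexHull ℝ _).linear_preimage f) hx

theorem nonneg_of_mem_parkingPolytope {x : Fin n → ℝ} (hx : x ∈ parkingPolytope u) (i : Fin n) :
    0 ≤ x i := by
  have h : (-LinearMap.proj i : Module.Dual ℝ (Fin n → ℝ)) x ≤ 0 :=
    le_of_forall_isParkingFunction (fun a ha => by simpa using ha.1 i) hx
  simpa using h

theorem comp_perm_mem_parkingPolytope (hu : Monotone u) {x : Fin n → ℝ}
    (hx : x ∈ parkingPolytope u) (τ : Equiv.Perm (Fin n)) : x ∘ τ ∈ parkingPolytope u := by
  refine map_mem_parkingPolytope (f := LinearMap.funLeft ℝ ℝ τ) (fun a ha => ?_) hx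
  obtain ⟨h0, σ, hσ⟩ := (isParkingFunction_iff_exists_perm hu).1 ha
  exact (isParkingFunction_iff_exists_perm hu).2 ⟨fun i => h0 (τ i), τ.trans σ, fun i => hσ (τ i)⟩

theorem update_zero_mem_parkingPolytope (hu : Monotone u) {x : Fin n → ℝ}
    (hx : x ∈ parkingPolytope u) (j : Fin n) : Function.update x j 0 ∈ parkingPolytope u := by
  let f : (Fin n → ℝ) →ₗ[ℝ] Fin n → ℝ :=
    LinearMap.id - LinearMap.single ℝ (fun _ => ℝ) j ∘ₗ LinearMap.proj j
  have hf : ∀ y, f y = Function.update y j 0 := fun y => by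
    ext i
    rcases eq_or_ne i j with rfl | hij <;> simp [f, *]
  rw [← hf]
  refine map_mem_parkingPolytope (fun a ha => ?_) hx
  have hle : 0 ≤ f a ∧ f a ≤ a := by
    rw [hf]
    exact ⟨le_update_iff.2 ⟨le_rfl, fun i _ => ha.1 i⟩,
      update_le_iff.2 ⟨ha.1 j, fun i _ => le_rfl⟩⟩
  obtain ⟨-, σ, hσ⟩ := (isParkingFunction_iff_exists_perm hu).1 ha
  exact (isParkingFunction_iff_exists_perm hu).2 ⟨hle.1, σ, fun i => (hle.2 i).trans (hσ i)⟩

/-- The move exchanges the coordinates `i` and `j`, or sends coordinate `j` to the ground. -/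
theorem add_smul_exchange_mem_parkingPolytope (hu : Monotone u) {x : Fin n → ℝ}
    (hx : x ∈ parkingPolytope u) (i : Option (Fin n)) (j : Fin n) :
    x + (x j - grounded x i) • exchange i j ∈ parkingPolytope u := by
  cases i with
  | none =>
    convert update_zero_mem_parkingPolytope hu hx j using 1
    ext a
    rcases eq_or_ne a j with rfl | haj <;> simp [exchange, *]
  | some i =>
    convert comp_perm_mem_parkingPolytope hu hx (Equiv.swap i j) using 1
    ext a
    simp only [exchange, Pi.add_apply, Pi.smul_apply, smul_eq_mul, Option.some.injEq,
      grounded_some, Function.comp_apply, Equiv.swap_apply_def]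
    split_ifs <;> grind

/-- Every entry of `u` indexed by `T` is at least every entry indexed outside of `T`. For such `T`
the polytope satisfies the inequality `∑ i ∈ T, x i ≤ ∑ i ∈ T, u i`, with equality at `x = u`. -/
def IsTop (u : Fin n → ℝ) (T : Finset (Fin n)) : Prop :=
  ∀ a ∈ T, ∀ b ∉ T, u b ≤ u a

theorem IsTop.sum_comp_perm_le {T : Finset (Fin n)} (hT : IsTop u T)
    (σ : Equiv.Perm (Fin n)) : ∑ i ∈ T, u (σ i) ≤ ∑ i ∈ T, u i := by
  have hmono : Monovary (fun i => if i ∈ T then (1 : ℝ) else 0) u := by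
    intro i j hij
    have hmem : i ∈ T → j ∈ T := fun hi => by_contra fun hj => (hT i hi j hj).not_gt hij
    by_cases hi : i ∈ T <;> by_cases hj : j ∈ T <;> simp_all
  simpa using hmono.sum_mul_comp_perm_le_sum_mul (σ := σ)

theorem IsTop.sum_le (hu : Monotone u) {T : Finset (Fin n)} (hT : IsTop u T) {x : Fin n → ℝ}
    (hx : x ∈ parkingPolytope u) : ∑ i ∈ T, x i ≤ ∑ i ∈ T, u i := by
  have h : (∑ i ∈ T, LinearMap.proj i : Module.Dual ℝ (Fin n → ℝ)) x ≤ ∑ i ∈ T, u i := by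
    refine le_of_forall_isParkingFunction (fun a ha => ?_) hx
    obtain ⟨-, σ, hσ⟩ := (isParkingFunction_iff_exists_perm hu).1 ha
    simpa using (Finset.sum_le_sum fun i _ => hσ i).trans (hT.sum_comp_perm_le σ)
  simpa using h

theorem self_mem_parkingPolytope (hu : Monotone u) (h0 : ∀ i, 0 ≤ u i) : u ∈ parkingPolytope u :=
  mem_parkingPolytope_of_le hu h0 1 fun _ => le_rfl

theorem isPolytope_parkingPolytope (hu : Monotone u) (h0 : ∀ i, 0 ≤ u i) :
    IsPolytope (parkingPolytope u) := by
  let S : Set (Fin n → ℝ) := ⋃ σ : Equiv.Perm (Fin n), Set.univ.pi fun i => {0, u (σ i)}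
  have hfin : S.Finite := Set.finite_iUnion fun σ => Set.Finite.pi fun i => Set.toFinite _
  refine ⟨hfin.toFinset, (Set.Finite.coe_toFinset hfin).symm ▸ Set.Subset.antisymm ?_ ?_⟩
  · refine convexHull_min (fun a ha => ?_) (convex_convexHull ℝ _)
    obtain ⟨ha0, σ, hσ⟩ := (isParkingFunction_iff_exists_perm hu).1 ha
    refine convexHull_mono (Set.subset_iUnion _ σ) ?_
    simp only [convexHull_pi, convexHull_pair, segment_eq_Icc (h0 _)]
    exact fun i _ => ⟨ha0 i, hσ i⟩
  · refine convexHull_mono fun a ha => ?_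
    obtain ⟨σ, hσ⟩ := Set.mem_iUnion.1 ha
    have hcases : ∀ i, a i = 0 ∨ a i = u (σ i) := fun i => hσ i trivial
    refine (isParkingFunction_iff_exists_perm hu).2 ⟨fun i => ?_, σ, fun i => ?_⟩ <;>
      rcases hcases i with h | h <;> simp [h, h0]

theorem single_mem_parkingPolytope (hu : Monotone u) (h0 : ∀ i, 0 ≤ u i) (i j : Fin n) :
    Pi.single i (u j) ∈ parkingPolytope u := by
  have hnonneg : (0 : Fin n → ℝ) ≤ Pi.single i (u j) := Pi.single_nonneg.2 (h0 j)
  refine mem_parkingPolytope_of_le hu hnonneg (Equiv.swap i j) fun k => ?_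
  rcases eq_or_ne k i with rfl | hki <;> simp [*]

theorem affineDim_parkingPolytope (hu : Monotone u) (h0 : ∀ i, 0 ≤ u i) (hne : u ≠ 0) :
    affineDim (parkingPolytope u) = n := by
  obtain ⟨j, hj : u j ≠ 0⟩ := Function.ne_iff.1 hne
  have hzero : (0 : Fin n → ℝ) ∈ parkingPolytope u :=
    mem_parkingPolytope_of_le hu (fun _ => le_rfl) 1 h0
  have hspan : vectorSpan ℝ (parkingPolytope u) = ⊤ := by
    rw [eq_top_iff, ← (Pi.basisFun ℝ (Fin n)).span_eq, Submodule.span_le]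
    rintro _ ⟨i, rfl⟩
    have h := Submodule.smul_mem _ (u j)⁻¹
      (vsub_mem_vectorSpan ℝ (single_mem_parkingPolytope hu h0 i j) hzero)
    rwa [vsub_eq_sub, sub_zero, ← Pi.single_smul, smul_eq_mul, inv_mul_cancel₀ hj,
      ← Pi.basisFun_apply ℝ] at h
  rw [affineDim, direction_affineSpan, hspan, finrank_top, Module.finrank_fin_fun]

theorem comp_perm_mem_parkingPolytope_iff (hu : Monotone u) {x : Fin n → ℝ}
    {τ : Equiv.Perm (Fin n)} : x ∘ τ ∈ parkingPolytope u ↔ x ∈ parkingPolytope u := by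
  refine ⟨fun h => ?_, fun h => comp_perm_mem_parkingPolytope hu h τ⟩
  simpa [Function.comp_assoc] using comp_perm_mem_parkingPolytope hu h τ.symm

/-- The vector `u` with its first `k` entries replaced by zero. Up to permuting coordinates, these
are the vertices of the parking function polytope of `u`. -/
def truncation (u : Fin n → ℝ) (k : ℕ) : Fin n → ℝ := fun i => if (i : ℕ) < k then 0 else u i

theorem truncation_of_lt {k : ℕ} {i : Fin n} (h : (i : ℕ) < k) : truncation u k i = 0 :=
  if_pos h

theorem truncation_of_le {k : ℕ} {i : Fin n} (h : k ≤ i) : truncation u k i = u i :=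
  if_neg h.not_gt

theorem truncation_nonneg (h0 : ∀ i, 0 ≤ u i) (k : ℕ) (i : Fin n) : 0 ≤ truncation u k i := by
  unfold truncation
  split_ifs <;> simp [h0]

theorem truncation_le (h0 : ∀ i, 0 ≤ u i) (k : ℕ) (i : Fin n) : truncation u k i ≤ u i := by
  unfold truncation
  split_ifs <;> simp [h0]

theorem truncation_mem_parkingPolytope (hu : Monotone u) (h0 : ∀ i, 0 ≤ u i) (k : ℕ) :
    truncation u k ∈ parkingPolytope u :=
  mem_parkingPolytope_of_le hu (truncation_nonneg h0 k) 1 (truncation_le h0 k)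

theorem exists_forall_val_lt_iff {p : Fin n → Prop} (hp : Antitone p) :
    ∃ k ≤ n, ∀ i : Fin n, (i : ℕ) < k ↔ p i := by
  classical
  refine ⟨(Finset.univ.filter p).card, card_finset_fin_le _, fun i => ⟨fun hi => ?_, fun hi => ?_⟩⟩
  · by_contra hpi
    have hsub : Finset.univ.filter p ⊆ Finset.Iio i := fun j hj => Finset.mem_Iio.2 <|
      not_le.1 fun hij => hpi (hp hij (Finset.mem_filter.1 hj).2)
    have hcard := Finset.card_le_card hsub
    rw [Fin.card_Iio] at hcard
    exact hi.not_ge hcard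
  · have hsub : Finset.Iic i ⊆ Finset.univ.filter p := fun j hj =>
      Finset.mem_filter.2 ⟨Finset.mem_univ j, hp (Finset.mem_Iic.1 hj) hi⟩
    simpa [Fin.card_Iic] using Finset.card_le_card hsub

theorem sum_mul_le_of_mem_parkingPolytope (hu : Monotone u) {c : Fin n → ℝ} (hc : Monotone c)
    {x : Fin n → ℝ} (hx : x ∈ parkingPolytope u) :
    ∑ i, c i * x i ≤ ∑ i, max (c i) 0 * u i := by
  have h : (∑ i, c i • LinearMap.proj i : Module.Dual ℝ (Fin n → ℝ)) x ≤
      ∑ i, max (c i) 0 * u i := by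
    refine le_of_forall_isParkingFunction (fun a ha => ?_) hx
    obtain ⟨ha0, σ, hσ⟩ := (isParkingFunction_iff_exists_perm hu).1 ha
    have hmono : Monovary (fun i => max (c i) 0) u := (hc.max monotone_const).monovary hu
    calc (∑ i, c i • LinearMap.proj i : Module.Dual ℝ (Fin n → ℝ)) a
        = ∑ i, c i * a i := by simp
      _ ≤ ∑ i, max (c i) 0 * u (σ i) := by
          gcongr with i
          · exact ha0 i
          · exact le_max_left _ _
          · exact hσ i
      _ ≤ ∑ i, max (c i) 0 * u i := hmono.sum_mul_comp_perm_le_sum_mul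
  simpa using h

theorem exists_eq_truncation_comp_of_isVertex (hu : Monotone u) (h0 : ∀ i, 0 ≤ u i)
    {v : Fin n → ℝ} (hv : IsVertex (parkingPolytope u) v) :
    ∃ k ≤ n, ∃ τ : Equiv.Perm (Fin n), v = truncation u k ∘ τ := by
  obtain ⟨l, hl⟩ := hv (Set.singleton_nonempty v)
  let c (i : Fin n) : ℝ := l (Pi.single i 1)
  let τ := Tuple.sort c
  have hmono : Monotone (c ∘ τ) := Tuple.monotone_sort c
  have hlin : ∀ x, l x = ∑ i, c (τ i) * x (τ i) := fun x => by
    rw [Equiv.sum_comp τ fun i => c i * x i]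
    conv_lhs => rw [← Finset.univ_sum_single x, map_sum]
    refine Finset.sum_congr rfl fun i _ => ?_
    rw [mul_comm, ← smul_eq_mul, ← map_smul, ← Pi.single_smul, smul_eq_mul, mul_one]
  obtain ⟨k, hkn, hk⟩ := exists_forall_val_lt_iff (p := fun i => c (τ i) ≤ 0)
    fun i j hij hj => (hmono hij).trans hj
  refine ⟨k, hkn, τ.symm, ?_⟩
  have hval : l (truncation u k ∘ τ.symm) = ∑ i, max (c (τ i)) 0 * u i := by
    rw [hlin]
    refine Finset.sum_congr rfl fun i _ => ?_
    rw [Function.comp_apply, Equiv.symm_apply_apply]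
    rcases lt_or_ge (i : ℕ) k with hi | hi
    · rw [truncation_of_lt hi, max_eq_right ((hk i).1 hi), mul_zero, zero_mul]
    · rw [truncation_of_le hi, max_eq_left (not_le.1 fun h => hi.not_gt ((hk i).2 h)).le]
  have hmem : truncation u k ∘ τ.symm ∈ ({v} : Set (Fin n → ℝ)) := hl ▸
    ⟨comp_perm_mem_parkingPolytope hu (truncation_mem_parkingPolytope hu h0 k) _, fun y hy => by
      rw [hval, hlin]
      exact sum_mul_le_of_mem_parkingPolytope hu hmono (comp_perm_mem_parkingPolytope hu hy τ)⟩
  exact hmem.symm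

/-- The parent map of a forest along which the coordinates of a vertex are exchanged: a path
`k ← k + 1 ← ⋯ ← b - 1` rooted at `k`, all `j ≥ b` attached to `b - 1`, and the `j < k` isolated. If
`b ≤ k`, then there are no edges. -/
def pathParent (k b : ℕ) (j : Fin n) : Option (Fin n) :=
  if k < min (j : ℕ) b then some ⟨min (j : ℕ) b - 1, by lia⟩ else none

/-- The descendants of `j` in the forest with parent map `pathParent k b`. -/
def pathDescendants (k b : ℕ) (j : Fin n) : Finset (Fin n) :=
  {i | i = j ∨ k ≤ j ∧ j < b ∧ j ≤ i}

theorem mem_pathDescendants {k b : ℕ} {i j : Fin n} :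
    i ∈ pathDescendants k b j ↔ (i : ℕ) = j ∨ k ≤ j ∧ j < b ∧ (j : ℕ) ≤ i := by
  simp [pathDescendants, Fin.ext_iff]

theorem isForest_path (k b : ℕ) : IsForest (pathParent (n := n) k b) (pathDescendants k b) where
  self_mem j := mem_pathDescendants.2 (.inl rfl)
  parent_notMem j := by
    unfold pathParent
    split_ifs <;> simp only [Finset.mem_map, Function.Embedding.some_apply, Option.some.injEq,
      exists_eq_right, mem_pathDescendants, reduceCtorEq, and_false, exists_false] <;> lia
  parent_mem_iff j l hlj := by
    unfold pathParent
    split_ifs <;> simp only [Finset.mem_map, Function.Embedding.some_apply, Option.some.injEq,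
      exists_eq_right, mem_pathDescendants, reduceCtorEq, and_false, exists_false] <;> lia

/-- The parent map of the tree obtained from `pathParent r b` by attaching the `j < r` to the
root `r`. -/
def treeParent (r : Fin n) (b : ℕ) (j : Fin n) : Option (Fin n) :=
  if j < r then some r else pathParent r b j

/-- The descendants of `j` in the tree with parent map `treeParent r b`. -/
def treeDescendants (r : Fin n) (b : ℕ) (j : Fin n) : Finset (Fin n) :=
  if j = r then Finset.univ else pathDescendants r b j

theorem isForest_tree {r : Fin n} {b : ℕ} (hb : (r : ℕ) < b) :
    IsForest (treeParent r b) (treeDescendants r b) where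
  self_mem j := by
    unfold treeDescendants
    split_ifs
    exacts [Finset.mem_univ j, (isForest_path r b).self_mem j]
  parent_notMem j := by
    unfold treeParent treeDescendants pathParent
    split_ifs <;> simp only [Finset.mem_map, Function.Embedding.some_apply, Option.some.injEq,
      exists_eq_right, mem_pathDescendants, Finset.mem_univ, reduceCtorEq, and_false,
      exists_false] <;> lia
  parent_mem_iff j l hlj := by
    unfold treeParent treeDescendants pathParent
    split_ifs <;> simp only [Finset.mem_map, Function.Embedding.some_apply, Option.some.injEq,
      exists_eq_right, mem_pathDescendants, Finset.mem_univ, reduceCtorEq, and_false,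
      exists_false] <;> lia

/-- The two thresholds of a monotone vector for which the polytope is simple: `u` vanishes below
`z`, is strictly increasing from `z` to `b`, and is constant from `b` on. If `u` has a zero entry,
then it is not constant from `z` on, unless `z = n - 1`. -/
structure IsStaircase (u : Fin n → ℝ) (z b : ℕ) : Prop where
  le_iff_pos : ∀ i : Fin n, z ≤ i ↔ 0 < u i
  le_of_le : ∀ i j : Fin n, b ≤ i → u j ≤ u i
  lt_of_lt : ∀ i j : Fin n, i < j → z ≤ i → (i : ℕ) < b → u i < u j
  lt_or_eq_zero : z < b ∨ z = 0

theorem exists_move_of_isTop (hu : Monotone u) {v : Fin n → ℝ} (hv : v ∈ parkingPolytope u)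
    {T : Finset (Fin n)} (hT : IsTop u T) (hvT : ∀ a ∈ T, v a = u a) {i : Option (Fin n)}
    {j : Fin n} (hij : grounded v i < v j) :
    ∃ c : ℝ, c ≠ 0 ∧ v + c • exchange i j ∈ parkingPolytope u ∧
      ∀ x ∈ parkingPolytope u, 0 ≤ c * (∑ a ∈ T, v a - ∑ a ∈ T, x a) := by
  refine ⟨v j - grounded v i, (sub_pos.2 hij).ne', add_smul_exchange_mem_parkingPolytope hu hv i j,
    fun x hx => mul_nonneg (sub_pos.2 hij).le ?_⟩
  rw [Finset.sum_congr rfl hvT]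
  exact sub_nonneg.2 (hT.sum_le hu hx)

theorem mul_sum_singleton_nonneg {v x : Fin n → ℝ} (hx : x ∈ parkingPolytope u) {j : Fin n}
    (hvj : v j = 0) {c : ℝ} (hc : c ≤ 0) :
    0 ≤ c * (∑ a ∈ {j}, v a - ∑ a ∈ {j}, x a) := by
  simpa [hvj] using mul_nonpos_of_nonpos_of_nonneg hc (nonneg_of_mem_parkingPolytope hx j)

theorem IsStaircase.isTop_pathDescendants {z b : ℕ} (h : IsStaircase u z b) (hu : Monotone u)
    {k : ℕ} {j : Fin n} (hkj : k ≤ j) : IsTop u (pathDescendants k b j) := by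
  intro i hi l hl
  rw [mem_pathDescendants] at hi hl
  by_cases hjb : (j : ℕ) < b
  · exact hu (Fin.le_def.2 (by lia))
  · exact h.le_of_le i l (by lia)

theorem IsStaircase.grounded_pathParent_lt {z b k : ℕ} (h : IsStaircase u z b) (hzk : z ≤ k)
    {j : Fin n} (hkj : k ≤ j) :
    grounded (truncation u k) (pathParent k b j) < truncation u k j := by
  rw [truncation_of_le hkj, pathParent]
  split_ifs with hk
  · rw [grounded_some, truncation_of_le (by simp; lia)]
    exact h.lt_of_lt _ _ (Fin.lt_def.2 (by simp; lia)) (by simp; lia) (by simp; lia)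
  · exact (h.le_iff_pos j).1 (hzk.trans hkj)

theorem IsStaircase.exists_move_of_le {z b k : ℕ} (h : IsStaircase u z b) (hu : Monotone u)
    (h0 : ∀ i, 0 ≤ u i) (hzk : z ≤ k) {j : Fin n} (hkj : k ≤ j) :
    ∃ c : ℝ, c ≠ 0 ∧ truncation u k + c • exchange (pathParent k b j) j ∈ parkingPolytope u ∧
      ∀ x ∈ parkingPolytope u, 0 ≤ c * (∑ i ∈ pathDescendants k b j, truncation u k i -
        ∑ i ∈ pathDescendants k b j, x i) := by
  refine exists_move_of_isTop hu (truncation_mem_parkingPolytope hu h0 k)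
    (h.isTop_pathDescendants hu hkj) (fun a ha => truncation_of_le ?_)
    (h.grounded_pathParent_lt hzk hkj)
  rw [mem_pathDescendants] at ha
  lia

theorem truncation_add_smul_exchange_mem_parkingPolytope (hu : Monotone u) (h0 : ∀ i, 0 ≤ u i)
    {q j : Fin n} (hjq : j ≤ q) :
    truncation u (q + 1) + -u q • exchange none j ∈ parkingPolytope u := by
  have heq : truncation u (q + 1) + -u q • exchange none j =
      fun i => if i = j then u q else truncation u (q + 1) i := by
    ext i
    rcases eq_or_ne i j with rfl | hij
    · simp [exchange, truncation_of_lt (Nat.lt_succ_of_le hjq)]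
    · simp [exchange, hij]
  rw [heq]
  refine mem_parkingPolytope_of_le hu (fun i => ?_) (Equiv.swap j q) fun i => ?_
  · split_ifs
    exacts [h0 q, truncation_nonneg h0 _ i]
  · rcases eq_or_ne i j with rfl | hij
    · simp
    rw [if_neg hij]
    rcases le_or_gt i q with hiq | hqi
    · exact (truncation_of_lt (Nat.lt_succ_of_le hiq)).trans_le (h0 _)
    · rw [Equiv.swap_apply_of_ne_of_ne hij hqi.ne']
      exact truncation_le h0 _ i

theorem IsStaircase.exists_isSimplicialAt_of_lt {z b k : ℕ} (h : IsStaircase u z b)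
    (hu : Monotone u) (h0 : ∀ i, 0 ≤ u i) (hkn : k ≤ n) (hzk : z < k ∨ z = 0) :
    ∃ b' : Module.Basis (Fin n) ℝ (Fin n → ℝ),
      IsSimplicialAt (parkingPolytope u) (truncation u k) b' := by
  refine (isForest_path k b).exists_isSimplicialAt (truncation_mem_parkingPolytope hu h0 k)
    fun j => ?_
  rcases le_or_gt k j with hkj | hjk
  · exact h.exists_move_of_le hu h0 (by lia) hkj
  obtain ⟨q, rfl⟩ : ∃ q : Fin n, k = q + 1 := ⟨⟨k - 1, by lia⟩, by simp; lia⟩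
  have hparent : pathParent (q + 1) b j = none := if_neg (by lia)
  have hdesc : pathDescendants (q + 1) b j = {j} := by
    ext i
    rw [mem_pathDescendants, Finset.mem_singleton, Fin.ext_iff]
    lia
  have hq : 0 < u q := (h.le_iff_pos q).1 (by lia)
  rw [hparent, hdesc]
  exact ⟨-u q, neg_ne_zero.2 hq.ne',
    truncation_add_smul_exchange_mem_parkingPolytope hu h0 (Nat.le_of_lt_succ hjk), fun x hx =>
    mul_sum_singleton_nonneg hx (truncation_of_lt hjk) (neg_nonpos.2 hq.le)⟩

theorem IsStaircase.eq_zero_of_lt {z b : ℕ} (h : IsStaircase u z b) (h0 : ∀ i, 0 ≤ u i)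
    {j : Fin n} (hj : (j : ℕ) < z) : u j = 0 :=
  (not_lt.1 fun hpos => hj.not_ge ((h.le_iff_pos j).2 hpos)).antisymm (h0 j)

theorem IsStaircase.truncation_eq_self {z b k : ℕ} (h : IsStaircase u z b) (h0 : ∀ i, 0 ≤ u i)
    (hkz : k ≤ z) : truncation u k = u := by
  ext i
  rcases lt_or_ge (i : ℕ) k with hi | hi
  · rw [truncation_of_lt hi, h.eq_zero_of_lt h0 (hi.trans_le hkz)]
  · exact truncation_of_le hi

theorem IsStaircase.exists_isSimplicialAt_self {r : Fin n} {b : ℕ} (h : IsStaircase u r b)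
    (hu : Monotone u) (h0 : ∀ i, 0 ≤ u i) (hb : (r : ℕ) < b) :
    ∃ b' : Module.Basis (Fin n) ℝ (Fin n → ℝ), IsSimplicialAt (parkingPolytope u) u b' := by
  have hr : 0 < u r := (h.le_iff_pos r).1 le_rfl
  have hmem := self_mem_parkingPolytope hu h0
  refine (isForest_tree hb).exists_isSimplicialAt hmem fun j => ?_
  rcases lt_trichotomy j r with hjr | rfl | hrj
  · have hj : u j = 0 := h.eq_zero_of_lt h0 hjr
    have hparent : treeParent r b j = some r := if_pos hjr
    have hdesc : treeDescendants r b j = {j} := by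
      ext i
      rw [treeDescendants, if_neg hjr.ne, mem_pathDescendants, Finset.mem_singleton, Fin.ext_iff]
      lia
    have hneg : u j - grounded u (some r) < 0 := by simpa [hj] using hr
    rw [hparent, hdesc]
    exact ⟨_, hneg.ne, add_smul_exchange_mem_parkingPolytope hu hmem _ j, fun x hx =>
      mul_sum_singleton_nonneg hx hj hneg.le⟩
  · have hparent : treeParent j b j = none := by simp [treeParent, pathParent]
    rw [hparent]
    refine exists_move_of_isTop hu hmem (fun a _ c hc => ?_) (fun _ _ => rfl) hr
    simp [treeDescendants] at hc
  · rw [treeParent, if_neg hrj.not_gt, treeDescendants, if_neg hrj.ne']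
    simpa only [h.truncation_eq_self h0 le_rfl] using h.exists_move_of_le hu h0 le_rfl hrj.le

theorem IsStaircase.exists_isSimplicialAt {z b k : ℕ} (h : IsStaircase u z b) (hu : Monotone u)
    (h0 : ∀ i, 0 ≤ u i) (hne : u ≠ 0) (hkn : k ≤ n) :
    ∃ b' : Module.Basis (Fin n) ℝ (Fin n → ℝ),
      IsSimplicialAt (parkingPolytope u) (truncation u k) b' := by
  rcases lt_or_ge z k with hzk | hkz
  · exact h.exists_isSimplicialAt_of_lt hu h0 hkn (.inl hzk)
  rcases h.lt_or_eq_zero with hzb | hz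
  · have hzn : z < n := by
      by_contra! hnz
      exact hne (funext fun i => h.eq_zero_of_lt h0 (i.isLt.trans_le hnz))
    rw [h.truncation_eq_self h0 hkz]
    exact IsStaircase.exists_isSimplicialAt_self (r := ⟨z, hzn⟩) h hu h0 hzb
  · exact h.exists_isSimplicialAt_of_lt hu h0 hkn (.inr hz)

/-- The condition on `u` under which its parking function polytope is simple: only the values zero
and the maximum may be repeated, and if zero occurs, then the maximum may be repeated only if it is
not the only positive value. -/
structure HasSimpleType (u : Fin n → ℝ) : Prop where
  eq_of_eq : ∀ i j k, 0 < u i → u i = u j → u i < u k → i = j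
  pos_or_exists_lt_or_eq : (∀ i, 0 < u i) ∨ (∃ i k, 0 < u i ∧ u i < u k) ∨
    ∀ i j, 0 < u i → u i = u j → i = j

theorem exists_forall_le_val_iff_pos (hu : Monotone u) :
    ∃ z ≤ n, ∀ i : Fin n, z ≤ i ↔ 0 < u i := by
  obtain ⟨z, hzn, hz⟩ := exists_forall_val_lt_iff (p := fun i => u i ≤ 0)
    fun i j hij hj => (hu hij).trans hj
  exact ⟨z, hzn, fun i => by rw [← not_lt, hz, not_le]⟩

theorem HasSimpleType.exists_isStaircase (h : HasSimpleType u) (hu : Monotone u)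
    (h0 : ∀ i, 0 ≤ u i) (hne : u ≠ 0) : ∃ z b, IsStaircase u z b := by
  obtain ⟨z, -, hz⟩ := exists_forall_le_val_iff_pos hu
  obtain ⟨b, -, hb⟩ := exists_forall_val_lt_iff (p := fun i => ∃ k, u i < u k)
    fun i j hij ⟨k, hk⟩ => ⟨k, (hu hij).trans_lt hk⟩
  have hmax : ∀ i j : Fin n, b ≤ i → u j ≤ u i := fun i j hi => not_lt.1 fun hij =>
    hi.not_gt ((hb i).2 ⟨j, hij⟩)
  have hlt : ∀ i j : Fin n, i < j → z ≤ i → (i : ℕ) < b → u i < u j := fun i j hij hzi hib =>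
    (hu hij.le).lt_of_ne fun heq =>
      hij.ne <| (hb i).1 hib |>.elim fun k hk => h.eq_of_eq i j k ((hz i).1 hzi) heq hk
  rcases h.pos_or_exists_lt_or_eq with hpos | ⟨i, k, hi, hik⟩ | hinj
  · refine ⟨0, b, by simpa using hpos, hmax, fun i j hij _ hib => hlt i j hij ?_ hib, .inr rfl⟩
    exact (hz i).2 (hpos i)
  · exact ⟨z, b, hz, hmax, hlt, .inl (((hz i).2 hi).trans_lt ((hb i).2 ⟨k, hik⟩))⟩
  · obtain ⟨t, ht⟩ := Function.ne_iff.1 hne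
    have hzt : z ≤ t := (hz t).2 ((h0 t).lt_of_ne' ht)
    exact ⟨z, n, hz, fun i _ hi => absurd i.isLt hi.not_gt, fun i j hij hzi _ =>
      (hu hij.le).lt_of_ne fun heq => hij.ne (hinj i j ((hz i).1 hzi) heq),
      .inl (hzt.trans_lt t.isLt)⟩

theorem HasSimpleType.isSimplePolytope (h : HasSimpleType u) (hu : Monotone u)
    (h0 : ∀ i, 0 ≤ u i) (hne : u ≠ 0) : IsSimplePolytope (parkingPolytope u) := by
  refine ⟨isPolytope_parkingPolytope hu h0, fun v hv => ?_⟩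
  obtain ⟨z, b, hzb⟩ := h.exists_isStaircase hu h0 hne
  obtain ⟨k, hkn, τ, rfl⟩ := exists_eq_truncation_comp_of_isVertex hu h0 hv
  obtain ⟨b', hb'⟩ := hzb.exists_isSimplicialAt hu h0 hne hkn
  have hτ := hb'.map (e := LinearEquiv.funCongrLeft ℝ ℝ τ) fun _ =>
    comp_perm_mem_parkingPolytope_iff hu
  rw [affineDim_parkingPolytope hu h0 hne]
  exact hτ.encard_edges.trans (by simp)

theorem sum_insert_eq_zero_iff {T : Finset (Fin n)} {a : Fin n} {y : Fin n → ℝ} (ha : a ∉ T)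
    (hT : ∑ i ∈ T, y i = 0) : ∑ i ∈ insert a T, y i = 0 ↔ y a = 0 := by
  rw [Finset.sum_insert ha, hT, add_zero]

theorem isTop_filter_lt (a : Fin n) : IsTop u {b | u a < u b} := by
  intro c hc b hb
  simp only [Finset.mem_filter, Finset.mem_univ, true_and] at hc hb
  linarith

theorem isTop_insert_filter_lt (a : Fin n) : IsTop u (insert a ({b | u a < u b} : Finset _)) := by
  intro c hc b hb
  simp only [Finset.mem_insert, Finset.mem_filter, Finset.mem_univ, true_and] at hc hb
  grind

theorem isTop_filter_le_ne (a : Fin n) : IsTop u {b | u a ≤ u b ∧ b ≠ a} := by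
  intro c hc b hb
  simp only [Finset.mem_filter, Finset.mem_univ, true_and] at hc hb
  grind

theorem isTop_insert_filter_le_ne (a : Fin n) :
    IsTop u (insert a ({b | u a ≤ u b ∧ b ≠ a} : Finset _)) := by
  intro c hc b hb
  simp only [Finset.mem_insert, Finset.mem_filter, Finset.mem_univ, true_and] at hc hb
  grind

/-- The functional whose maximum over the polytope is described by `IsTop.sum_le`. -/
noncomputable def sumOver (T : Finset (Fin n)) : StrongDual ℝ (Fin n → ℝ) :=
  ∑ i ∈ T, ContinuousLinearMap.proj i

theorem sumOver_apply (T : Finset (Fin n)) (x : Fin n → ℝ) : sumOver T x = ∑ i ∈ T, x i := by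
  simp [sumOver]

theorem isVertex_parkingPolytope_self (hu : Monotone u) (h0 : ∀ i, 0 ≤ u i) :
    IsVertex (parkingPolytope u) u := by
  have hmem := self_mem_parkingPolytope hu h0
  have hface : faceAlong (parkingPolytope u) u ⊥ = {u} := by
    ext x
    simp only [faceAlong, Submodule.mem_bot, sub_eq_zero, Set.mem_singleton_iff]
    exact ⟨And.right, fun hx => ⟨hx ▸ hmem, hx⟩⟩
  unfold IsVertex
  rw [← hface]
  refine isExposed_faceAlong hmem (fun T : {T // IsTop u T} => sumOver T) (fun T x hx => ?_)
    fun y => ⟨fun hy T => ?_, fun hy => ?_⟩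
  · simpa only [sumOver_apply] using T.2.sum_le hu hx
  · rw [(Submodule.mem_bot ℝ).1 hy, map_zero]
  · simp only [sumOver_apply, Subtype.forall] at hy
    exact (Submodule.mem_bot ℝ).2 <| funext fun a =>
      (sum_insert_eq_zero_iff (by simp) (hy _ (isTop_filter_lt a))).1
        (hy _ (isTop_insert_filter_lt a))

/-- `grounded u i < u j` are consecutive among zero and the entries of `u`. These pairs label edges
at the vertex `u`, and exchanging the coordinates `i` and `j` of `u` leads to the other end. -/
structure IsCover (u : Fin n → ℝ) (i : Option (Fin n)) (j : Fin n) : Prop where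
  lt : grounded u i < u j
  le_or_le : ∀ k, u k ≤ grounded u i ∨ u j ≤ u k

theorem IsCover.ne {i : Option (Fin n)} {j : Fin n} (h : IsCover u i j) : i ≠ some j := by
  rintro rfl
  exact h.lt.false

theorem grounded_nonneg (h0 : ∀ i, 0 ≤ u i) (i : Option (Fin n)) : 0 ≤ grounded u i := by
  cases i
  exacts [le_rfl, h0 _]

theorem mem_span_exchange {i : Option (Fin n)} {j : Fin n} (hij : i ≠ some j) {y : Fin n → ℝ}
    (hoff : ∀ a, some a ≠ i → a ≠ j → y a = 0) (hsum : i ≠ none → ∑ a, y a = 0) :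
    y ∈ ℝ ∙ exchange i j := by
  refine Submodule.mem_span_singleton.2 ⟨-y j, funext fun a => ?_⟩
  rw [Pi.smul_apply, smul_eq_mul]
  by_cases haj : a = j
  · rw [haj, exchange_self_right hij]
    ring
  by_cases hai : some a = i
  · subst hai
    have hya : y a + y j = 0 := by
      rw [← hsum (Option.some_ne_none a), Finset.sum_eq_add a j haj
        (fun b _ hb => hoff b (by simpa using hb.1) hb.2) (by simp) (by simp)]
    simp only [exchange, if_true, if_neg haj]
    linarith
  · simp [exchange, hai, haj, hoff a hai haj]

/-- The sets `T` for which the inequality of `IsTop.sum_le` stays tight along the move from `u`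
given by the exchange of `i` and `j`. -/
def IsTightTop (u : Fin n → ℝ) (i : Option (Fin n)) (j : Fin n) (T : Finset (Fin n)) : Prop :=
  IsTop u T ∧ (i ∈ T.map .some ↔ j ∈ T)

theorem IsTightTop.sum_exchange {i : Option (Fin n)} {j : Fin n} {T : Finset (Fin n)}
    (h : IsTightTop u i j T) : ∑ a ∈ T, exchange i j a = 0 := by
  simp only [ParkingPolytope.sum_exchange, h.2, sub_self]

theorem isTightTop_none {j : Fin n} {T : Finset (Fin n)} :
    IsTightTop u none j T ↔ IsTop u T ∧ j ∉ T := by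
  simp [IsTightTop]

theorem isTightTop_some {i j : Fin n} {T : Finset (Fin n)} :
    IsTightTop u (some i) j T ↔ IsTop u T ∧ (i ∈ T ↔ j ∈ T) := by
  simp [IsTightTop]

theorem isTightTop_univ (i j : Fin n) : IsTightTop u (some i) j Finset.univ :=
  isTightTop_some.2 ⟨fun _ _ b hb => absurd (Finset.mem_univ b) hb, by simp⟩

theorem IsCover.exists_isTightTop {i : Option (Fin n)} {j : Fin n} (h : IsCover u i j)
    (h0 : ∀ i, 0 ≤ u i) {a : Fin n} (hai : some a ≠ i) (haj : a ≠ j) (ha : u a ≠ 0) :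
    ∃ T, a ∉ T ∧ IsTightTop u i j T ∧ IsTightTop u i j (insert a T) := by
  rcases i with - | i
  · have hja : u j ≤ u a := (h.le_or_le a).resolve_left ((h0 a).lt_of_ne' ha).not_ge
    exact ⟨.filter (u a < u ·) .univ, by simp, isTightTop_none.2 ⟨isTop_filter_lt a, by grind⟩,
      isTightTop_none.2 ⟨isTop_insert_filter_lt a, by grind⟩⟩
  have hij : u i < u j := h.lt
  rcases h.le_or_le a with hle | hja
  · have hai' : u a ≤ u i := hle
    exact ⟨.filter (fun b => u a ≤ u b ∧ b ≠ a) .univ, by simp,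
      isTightTop_some.2 ⟨isTop_filter_le_ne a, by grind⟩,
      isTightTop_some.2 ⟨isTop_insert_filter_le_ne a, by grind⟩⟩
  · exact ⟨.filter (u a < u ·) .univ, by simp, isTightTop_some.2 ⟨isTop_filter_lt a, by grind⟩,
      isTightTop_some.2 ⟨isTop_insert_filter_lt a, by grind⟩⟩

theorem IsCover.isEdge_faceAlong {i : Option (Fin n)} {j : Fin n} (h : IsCover u i j)
    (hu : Monotone u) (h0 : ∀ i, 0 ≤ u i) :
    IsEdge (parkingPolytope u)
      (faceAlong (parkingPolytope u) u (ℝ ∙ (u j - grounded u i) • exchange i j)) := by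
  have hmem := self_mem_parkingPolytope hu h0
  have hpos : u j - grounded u i ≠ 0 := (sub_pos.2 h.lt).ne'
  have hne : exchange i j ≠ 0 := fun he => by
    simpa [he] using exchange_self_right h.ne
  refine ParkingPolytope.isEdge_faceAlong
    (κ := {T // IsTightTop u i j T} ⊕ {k // u k = 0 ∧ some k ≠ i}) hmem
    (add_smul_exchange_mem_parkingPolytope hu hmem i j) (smul_ne_zero hpos hne)
    (Sum.elim (fun T => sumOver T) fun k => -ContinuousLinearMap.proj k.1) ?_ fun y => ?_
  · rintro (T | k) x hx
    · simpa only [Sum.elim_inl, sumOver_apply] using T.2.1.sum_le hu hx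
    · simpa [k.2.1] using nonneg_of_mem_parkingPolytope hx k
  rw [Submodule.span_singleton_smul_eq hpos.isUnit]
  constructor
  · intro hy
    obtain ⟨c, rfl⟩ := Submodule.mem_span_singleton.1 hy
    rintro (T | ⟨k, hk, hki⟩)
    · rw [Sum.elim_inl, map_smul, sumOver_apply, T.2.sum_exchange, smul_zero]
    · have hkj : k ≠ j := by
        rintro rfl
        exact ((grounded_nonneg h0 i).trans_lt h.lt).ne' hk
      simp [exchange, hki, hkj]
  · intro hy
    have hsum : ∀ T, IsTightTop u i j T → ∑ a ∈ T, y a = 0 := fun T hT => by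
      simpa only [Sum.elim_inl, sumOver_apply] using hy (.inl ⟨T, hT⟩)
    refine mem_span_exchange h.ne (fun a hai haj => ?_) fun hi => ?_
    · by_cases ha : u a = 0
      · simpa using hy (.inr ⟨a, ha, hai⟩)
      · obtain ⟨T, haT, hT, hT'⟩ := h.exists_isTightTop h0 hai haj ha
        exact (sum_insert_eq_zero_iff haT (hsum T hT)).1 (hsum _ hT')
    · obtain ⟨i, rfl⟩ := Option.ne_none_iff_exists'.1 hi
      exact hsum _ (isTightTop_univ i j)

theorem exchange_injective_left (j : Fin n) :
    Function.Injective fun i : Option (Fin n) => exchange i j := by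
  intro i i' h
  ext a
  have ha := congrFun h a
  simp only [exchange, sub_left_inj] at ha
  grind

theorem IsCover.eq_of_exchange_mem_span {i i' : Option (Fin n)} {j j' : Fin n}
    (h : IsCover u i j) (h' : IsCover u i' j') (hmem : exchange i j ∈ ℝ ∙ exchange i' j') :
    (i, j) = (i', j') := by
  obtain ⟨c, hc⟩ := Submodule.mem_span_singleton.1 hmem
  have happ : ∀ a, c * exchange i' j' a = exchange i j a := congrFun hc
  have hj := happ j
  have hj' := happ j'
  rw [exchange_self_right h.ne] at hj
  rw [exchange_self_right h'.ne] at hj'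
  rcases eq_or_ne j j' with rfl | hne
  · obtain rfl : c = 1 := by rw [exchange_self_right h'.ne] at hj; linarith
    rw [one_smul] at hc
    exact Prod.ext (exchange_injective_left j hc.symm) rfl
  -- A negative multiple would exchange the two coordinates in opposite directions.
  · have hi' : i' = some j := by
      by_contra hi'
      simp [exchange, hne, Ne.symm hi'] at hj
    have hi : i = some j' := by
      by_contra hi
      have hc0 : c = 0 := by simpa [exchange, hne.symm, Ne.symm hi] using hj'
      simp [hc0] at hj
    exact absurd h.lt (by simpa [hi, hi'] using h'.lt.le)

theorem card_isCover_le_encard_edges (hu : Monotone u) (h0 : ∀ i, 0 ≤ u i) :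
    ENat.card {p : Option (Fin n) × Fin n // IsCover u p.1 p.2} ≤
      {F | IsEdge (parkingPolytope u) F ∧ u ∈ F}.encard := by
  have hmem := self_mem_parkingPolytope hu h0
  refine ENat.card_le_card_of_injective (f := fun p =>
    (⟨_, p.2.isEdge_faceAlong hu h0, self_mem_faceAlong hmem⟩ :
      {F | IsEdge (parkingPolytope u) F ∧ u ∈ F})) fun p p' hpp' => Subtype.ext ?_
  have hspan := mem_span_singleton_of_faceAlong_eq
    (add_smul_exchange_mem_parkingPolytope hu hmem _ _) (Subtype.ext_iff.1 hpp')
  have hp : u p.1.2 - grounded u p.1.1 ≠ 0 := (sub_pos.2 p.2.lt).ne'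
  have hp' : u p'.1.2 - grounded u p'.1.1 ≠ 0 := (sub_pos.2 p'.2.lt).ne'
  rw [Submodule.span_singleton_smul_eq hp'.isUnit, Submodule.smul_mem_iff _ hp] at hspan
  exact p.2.eq_of_exchange_mem_span p'.2 hspan

theorem exists_isCover_right {i : Option (Fin n)} {k : Fin n} (h : grounded u i < u k) :
    ∃ j, IsCover u i j := by
  obtain ⟨j, hj, hmin⟩ := Set.exists_min_image {j | grounded u i < u j} u (Set.toFinite _) ⟨k, h⟩
  exact ⟨j, hj, fun l => or_iff_not_imp_left.2 fun hl => hmin l (not_le.1 hl)⟩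

theorem exists_isCover_left {j : Fin n} (h : 0 < u j) :
    ∃ i, IsCover u i j ∧ (grounded u i = 0 → i = none) := by
  obtain ⟨i, ⟨hij, hi⟩, hmax⟩ := Set.exists_max_image
    {i | grounded u i < u j ∧ (i = none ∨ 0 < grounded u i)} (grounded u) (Set.toFinite _)
    ⟨none, h, .inl rfl⟩
  refine ⟨i, ⟨hij, fun k => ?_⟩, fun hi0 => hi.resolve_right hi0.not_gt⟩
  rw [or_iff_not_imp_right, not_le]
  intro hkj
  rcases le_or_gt (u k) 0 with hk | hk
  · exact hk.trans (hmax none ⟨h, .inl rfl⟩)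
  · exact hmax (some k) ⟨hkj, .inr hk⟩

/-- The coordinate charged for the cover `p = (i, j)`: it is `j`, unless `i` is a zero entry. Every
coordinate is charged, and the polytope is not simple if one is charged twice. -/
noncomputable def chargedIndex (u : Fin n → ℝ) (p : Option (Fin n) × Fin n) : Fin n :=
  if grounded u p.1 = 0 then p.1.getD p.2 else p.2

theorem exists_isCover_chargedIndex_eq (h0 : ∀ i, 0 ≤ u i) (hne : u ≠ 0) (k : Fin n) :
    ∃ p : Option (Fin n) × Fin n, IsCover u p.1 p.2 ∧ chargedIndex u p = k := by
  rcases (h0 k).eq_or_lt' with hk | hk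
  · obtain ⟨t, ht⟩ := Function.ne_iff.1 hne
    obtain ⟨j, hj⟩ := exists_isCover_right (u := u) (i := some k) (k := t)
      (by simpa [hk] using (h0 t).lt_of_ne' ht)
    exact ⟨(some k, j), hj, by simp [chargedIndex, hk]⟩
  · obtain ⟨i, hi, hi0⟩ := exists_isCover_left hk
    refine ⟨(i, k), hi, ?_⟩
    unfold chargedIndex
    split_ifs with h
    exacts [by simp [hi0 h], rfl]

theorem injOn_chargedIndex (hu : Monotone u) (h0 : ∀ i, 0 ≤ u i) (hne : u ≠ 0)
    (h : IsSimplePolytope (parkingPolytope u)) :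
    Set.InjOn (chargedIndex u) {p | IsCover u p.1 p.2} := by
  have hcard := card_isCover_le_encard_edges hu h0
  rw [h.2 u (isVertex_parkingPolytope_self hu h0), affineDim_parkingPolytope hu h0 hne,
    ENat.card_eq_coe_natCard, Nat.cast_le] at hcard
  have hsurj : Function.Surjective ({p | IsCover u p.1 p.2}.domRestrict (chargedIndex u)) :=
    fun k =>
      let ⟨p, hp, hpk⟩ := exists_isCover_chargedIndex_eq h0 hne k
      ⟨⟨p, hp⟩, hpk⟩
  exact Set.injOn_iff_injective.2
    (hsurj.bijective_of_nat_card_le (hcard.trans_eq (Nat.card_fin n).symm)).1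

theorem HasSimpleType.of_isSimplePolytope (hu : Monotone u) (h0 : ∀ i, 0 ≤ u i) (hne : u ≠ 0)
    (h : IsSimplePolytope (parkingPolytope u)) : HasSimpleType u where
  eq_of_eq i j k hi hij hik := by
    obtain ⟨l, hl⟩ := exists_isCover_right (i := some i) hik
    have hl' : IsCover u (some j) l := ⟨by simpa [← hij] using hl.lt, by simpa [← hij] using hl.2⟩
    have hpair := injOn_chargedIndex hu h0 hne h (x₁ := (some i, l)) (x₂ := (some j, l)) hl hl'
      (by simp [chargedIndex, ← hij, hi.ne'])
    simpa using hpair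
  pos_or_exists_lt_or_eq := by
    rw [or_iff_not_imp_left, or_iff_not_imp_left]
    intro hpos hconst i j hi hij
    push Not at hpos hconst
    obtain ⟨z, hz⟩ := hpos
    have hz0 : u z = 0 := hz.antisymm (h0 z)
    have hcover : ∀ l, 0 < u l → IsCover u (some z) l := fun l hl =>
      ⟨by simpa [hz0] using hl, fun k => by
        simpa [hz0] using (le_or_gt (u k) 0).imp_right fun hk => hconst k l hk⟩
    have hpair := injOn_chargedIndex hu h0 hne h (x₁ := (some z, i)) (x₂ := (some z, j))
      (hcover i hi) (hcover j (hij ▸ hi)) (by simp [chargedIndex, hz0])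
    simpa using hpair

theorem isSimplePolytope_parkingPolytope_iff (hu : Monotone u) (h0 : ∀ i, 0 ≤ u i) (hne : u ≠ 0) :
    IsSimplePolytope (parkingPolytope u) ↔ HasSimpleType u :=
  ⟨.of_isSimplePolytope hu h0 hne, fun h => h.isSimplePolytope hu h0 hne⟩

end Polytope

end ParkingPolytope

namespace IsMDPair

variable {n ℓ : ℕ} {u : Fin n → ℝ} {m : Fin (ℓ + 1) → ℕ} {d : Fin ℓ → ℝ}

theorem exists_eq_of_pos (h : IsMDPair u m d) {j : Fin n} (hj : 0 < u j) : ∃ i, d i = u j := by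
  rw [← Set.mem_range, h.range_eq]
  exact ⟨⟨j, rfl⟩, hj⟩

theorem pos_and_exists_eq (h : IsMDPair u m d) (i : Fin ℓ) : 0 < d i ∧ ∃ j, u j = d i :=
  and_comm.1 (h.range_eq.subset (Set.mem_range_self i))

theorem length_pos (h : IsMDPair u m d) : 0 < ℓ := by
  obtain ⟨j, hj⟩ := Function.ne_iff.1 h.ne_zero
  obtain ⟨i, -⟩ := h.exists_eq_of_pos ((h.nonneg j).lt_of_ne' hj)
  exact i.pos

theorem two_le_length_iff (h : IsMDPair u m d) : 2 ≤ ℓ ↔ ∃ j k, 0 < u j ∧ u j < u k := by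
  constructor
  · intro hℓ
    obtain ⟨hpos, j, hj⟩ := h.pos_and_exists_eq ⟨0, by lia⟩
    obtain ⟨-, k, hk⟩ := h.pos_and_exists_eq ⟨1, hℓ⟩
    exact ⟨j, k, hj ▸ hpos, hj ▸ hk ▸ h.strictMono (Fin.lt_def.2 zero_lt_one)⟩
  · rintro ⟨j, k, hj, hjk⟩
    obtain ⟨i, hi⟩ := h.exists_eq_of_pos hj
    obtain ⟨i', hi'⟩ := h.exists_eq_of_pos (hj.trans hjk)
    rw [← hi, ← hi', h.strictMono.lt_iff_lt, Fin.lt_def] at hjk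
    lia

theorem mult_zero_eq_zero_iff (h : IsMDPair u m d) : m 0 = 0 ↔ ∀ j, 0 < u j := by
  rw [h.mult_zero, Finset.card_eq_zero, Finset.filter_eq_empty_iff]
  simp [(h.nonneg _).lt_iff_ne']

theorem mult_succ_eq_one_iff (h : IsMDPair u m d) (i : Fin ℓ) :
    m i.succ = 1 ↔ ∀ j k, u j = d i → u j = u k → j = k := by
  obtain ⟨-, j, hj⟩ := h.pos_and_exists_eq i
  have hpos : 0 < m i.succ := by
    rw [h.mult_succ]
    exact Finset.card_pos.2 ⟨j, by simpa using hj⟩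
  have hle : m i.succ ≤ 1 ↔ ∀ j k, u j = d i → u j = u k → j = k := by
    rw [h.mult_succ, Finset.card_le_one]
    simp only [Finset.mem_filter_univ]
    exact ⟨fun h j k hj hjk => h j hj k (hjk ▸ hj), fun h j hj k hk => h j k hj (hj.trans hk.symm)⟩
  rw [← hle]
  lia

theorem forall_mult_succ_eq_one_iff (h : IsMDPair u m d) :
    (∀ i : Fin ℓ, m i.succ = 1) ↔ ∀ j k, 0 < u j → u j = u k → j = k := by
  simp only [h.mult_succ_eq_one_iff]
  constructor
  · intro hone j k hj
    obtain ⟨i, hi⟩ := h.exists_eq_of_pos hj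
    exact hone i j k hi.symm
  · intro hinj i j k hj
    exact hinj j k (hj ▸ (h.pos_and_exists_eq i).1)

theorem forall_mult_succ_eq_one_of_lt_iff (h : IsMDPair u m d) :
    (∀ i : Fin ℓ, (i : ℕ) + 1 < ℓ → m i.succ = 1) ↔
      ∀ j k l, 0 < u j → u j = u k → u j < u l → j = k := by
  simp only [h.mult_succ_eq_one_iff]
  constructor
  · intro hone j k l hj hjk hjl
    obtain ⟨i, hi⟩ := h.exists_eq_of_pos hj
    obtain ⟨i', hi'⟩ := h.exists_eq_of_pos (hj.trans hjl)
    rw [← hi, ← hi', h.strictMono.lt_iff_lt, Fin.lt_def] at hjl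
    exact hone i (by lia) j k hi.symm hjk
  · intro hinj i hi j k hj hjk
    obtain ⟨-, l, hl⟩ := h.pos_and_exists_eq ⟨i + 1, hi⟩
    refine hinj j k l (hj ▸ (h.pos_and_exists_eq i).1) hjk ?_
    rw [hj, hl]
    exact h.strictMono (Fin.lt_def.2 (Nat.lt_succ_self i))

theorem sum_mult (h : IsMDPair u m d) : ∑ i, m i = n := by
  have hm : ∀ i, m i = (Finset.univ.filter fun j => u j = Fin.cons (α := fun _ => ℝ) 0 d i).card :=
    Fin.cases (by simpa using h.mult_zero) fun i => by simpa using h.mult_succ i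
  have hinj : Function.Injective (Fin.cons 0 d : Fin (ℓ + 1) → ℝ) :=
    Fin.cons_injective_iff.2
      ⟨fun ⟨i, hi⟩ => (h.pos_and_exists_eq i).1.ne' hi, h.strictMono.injective⟩
  have hval : ∀ j, ∃ i, Fin.cons (α := fun _ => ℝ) 0 d i = u j := fun j => by
    rcases (h.nonneg j).eq_or_lt' with hj | hj
    · exact ⟨0, hj.symm⟩
    · obtain ⟨i, hi⟩ := h.exists_eq_of_pos hj
      exact ⟨i.succ, hi⟩
  choose f hf using hval
  calc ∑ i, m i = ∑ i, (Finset.univ.filter fun j => f j = i).card := by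
        refine Finset.sum_congr rfl fun i _ => ?_
        simp only [hm, ← hf, hinj.eq_iff]
    _ = n := by
        rw [← Finset.card_eq_sum_card_fiberwise fun _ _ => Finset.mem_coe.2 (Finset.mem_univ _),
          Finset.card_fin]

theorem hasSimpleType_iff (h : IsMDPair u m d) : ParkingPolytope.HasSimpleType u ↔
    (∀ i : Fin ℓ, (i : ℕ) + 1 < ℓ → m i.succ = 1) ∧
      (m 0 = 0 ∨ 2 ≤ ℓ ∨ ∀ i : Fin ℓ, m i.succ = 1) := by
  rw [h.forall_mult_succ_eq_one_of_lt_iff, h.mult_zero_eq_zero_iff, h.two_le_length_iff,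
    h.forall_mult_succ_eq_one_iff]
  exact ⟨fun ⟨h₁, h₂⟩ => ⟨h₁, h₂⟩, fun ⟨h₁, h₂⟩ => ⟨h₁, h₂⟩⟩

end IsMDPair

theorem ParkingPolytope.ofFn_eq_or_ofFn_eq_or_iff {n ℓ : ℕ} {m : Fin (ℓ + 1) → ℕ} (hℓ : 0 < ℓ)
    (hsum : ∑ i, m i = n) :
    (List.ofFn m = [0, n] ∨ List.ofFn m = [n - 1, 1] ∨
        (2 ≤ ℓ ∧ ∀ i : Fin (ℓ + 1), 1 ≤ (i : ℕ) → (i : ℕ) ≤ ℓ - 1 → m i = 1)) ↔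
      (∀ i : Fin ℓ, (i : ℕ) + 1 < ℓ → m i.succ = 1) ∧
        (m 0 = 0 ∨ 2 ≤ ℓ ∨ ∀ i : Fin ℓ, m i.succ = 1) := by
  rcases eq_or_ne ℓ 1 with rfl | hℓ1
  · have hlist : ∀ a b, List.ofFn m = [a, b] ↔ m 0 = a ∧ m 1 = b := by simp [List.ofFn_succ]
    rw [Fin.sum_univ_two] at hsum
    simp only [hlist, Fin.forall_fin_one, Fin.succ_zero_eq_one]
    lia
  · have h2 : 2 ≤ ℓ := by lia
    have hlist : ∀ a b, List.ofFn m ≠ [a, b] := fun a b hab =>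
      hℓ1 (by simpa using congrArg List.length hab)
    have hshift : (∀ i : Fin (ℓ + 1), 1 ≤ (i : ℕ) → (i : ℕ) ≤ ℓ - 1 → m i = 1) ↔
        ∀ i : Fin ℓ, (i : ℕ) + 1 < ℓ → m i.succ = 1 := by
      simp [Fin.forall_fin_succ, Nat.lt_sub_iff_add_lt]
    simp only [hlist, h2, hshift, true_or, or_true, and_true, false_or, true_and]

theorem mainTheorem8 {n ℓ : ℕ} (u : Fin n → ℝ) (m : Fin (ℓ + 1) → ℕ) (d : Fin ℓ → ℝ)
    (h : IsMDPair u m d) :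
    IsSimplePolytope (parkingPolytope u) ↔
      List.ofFn m = [0, n] ∨ List.ofFn m = [n - 1, 1] ∨
        (2 ≤ ℓ ∧ ∀ i : Fin (ℓ + 1), 1 ≤ (i : ℕ) → (i : ℕ) ≤ ℓ - 1 → m i = 1) := by
  rw [ParkingPolytope.isSimplePolytope_parkingPolytope_iff h.monotone h.nonneg h.ne_zero,
    h.hasSimpleType_iff, ParkingPolytope.ofFn_eq_or_ofFn_eq_or_iff h.length_pos h.sum_mult]
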